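/- Let $\mathbb{E}^2$ be the Euclidean plane. A closed Euclidean $2$-orbifold is a compact quotient $X=\mathbb{E}^2/\Gamma$, where $\Gamma$ is a group of isometries of $\mathbb{E}^2$ acting properly discontinuously (orientation-reversing isometries and isometries with fixed points are allowed); its (orbifold) fundamental group is the group of deck transformations of the universal orbifold covering $\mathbb{E}^2\to X$, that is, the group of isometries $g$ of $\mathbb{E}^2$ that commute with the projection to $X$ (this group is $\Gamma$). Let $G$ be a group isomorphic to the fundamental group of a closed Euclidean $2$-orbifold, let $\hat G=\varprojlim G/N$ be its profinite completion, where $N$ ranges over the normal subgroups of finite index in $G$, and let $\iota\colon G\to\hat G$ be the canonical homomorphism. Then: 1. for every element $\gamma\in\hat G$ of finite order there is an element $g\in G$ of finite order such that $\gamma$ is conjugate to $\iota(g)$ in $\hat G$; 2. if $g,h\in G$ have finite order and $\iota(g)$ and $\iota(h)$ are conjugate in $\hat G$, then $g$ and $h$ are conjugate in $G$. -/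

import Mathlib

/-- The Euclidean plane. -/
abbrev EuclideanPlane : Type := EuclideanSpace ℝ (Fin 2)

/-- The tautological action of the isometry group of the plane on the plane. -/
noncomputable instance EuclideanPlane.isometryAction :
    MulAction (EuclideanPlane ≃ᵢ EuclideanPlane) EuclideanPlane where
  smul g x := g x
  one_smul _ := rfl
  mul_smul _ _ _ := rfl

/-- A closed Euclidean 2-orbifold: the compact quotient of the Euclidean plane by a group of
isometries acting properly discontinuously (equivalently, by a discrete group of isometries).
The isometries may reverse orientation and may have fixed points. -/
structure ClosedEuclideanTwoOrbifold where
  /-- The group whose orbits are the points of the orbifold. -/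
  group : Subgroup (EuclideanPlane ≃ᵢ EuclideanPlane)
  properlyDiscontinuous : ProperlyDiscontinuousSMul group EuclideanPlane
  compact : CompactSpace (Quotient (MulAction.orbitRel group EuclideanPlane))

namespace ClosedEuclideanTwoOrbifold

/-- The underlying topological space of the orbifold. -/
abbrev Carrier (X : ClosedEuclideanTwoOrbifold) : Type :=
  Quotient (MulAction.orbitRel X.group EuclideanPlane)

/-- The universal orbifold covering of `X`; its total space, the plane, is simply connected. -/
noncomputable def covering (X : ClosedEuclideanTwoOrbifold) : EuclideanPlane → X.Carrier :=
  Quotient.mk _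

/-- The orbifold fundamental group of `X`: the group of deck transformations of its universal
orbifold covering, that is, of the isometries of the plane that commute with the projection
to `X`. -/
def fundamentalGroup (X : ClosedEuclideanTwoOrbifold) :
    Subgroup (EuclideanPlane ≃ᵢ EuclideanPlane) where
  carrier := {g | ∀ x, X.covering (g x) = X.covering x}
  one_mem' _ := rfl
  mul_mem' {g h} hg hh x := (hg (h x)).trans (hh x)
  inv_mem' {g} hg x := by
    have h := hg (g⁻¹ x)
    rw [IsometryEquiv.apply_inv_self] at h
    exact h.symm

theorem mem_fundamentalGroup_iff_forall (X : ClosedEuclideanTwoOrbifold)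
    (g : EuclideanPlane ≃ᵢ EuclideanPlane) :
    g ∈ X.fundamentalGroup ↔ ∀ x, ∃ γ ∈ X.group, γ x = g x := by
  refine forall_congr' fun x => ?_
  refine Quotient.eq.trans ?_
  rw [MulAction.orbitRel_apply, MulAction.mem_orbit_iff]
  exact ⟨fun ⟨γ, h⟩ => ⟨γ.1, γ.2, h⟩, fun ⟨γ, hγ, h⟩ => ⟨⟨γ, hγ⟩, h⟩⟩

/-- The deck transformation group is the group that defines the orbifold. -/
theorem fundamentalGroup_eq_group (X : ClosedEuclideanTwoOrbifold) :
    X.fundamentalGroup = X.group := by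
  ext g
  rw [mem_fundamentalGroup_iff_forall]
  refine ⟨fun hg => ?_, fun hg x => ⟨g, hg, rfl⟩⟩
  have hcount : Countable X.group := by
    have hpd := X.properlyDiscontinuous
    rw [← Set.countable_univ_iff]
    refine (Set.countable_iUnion fun n : ℕ =>
      (hpd.finite_disjoint_inter_image (isCompact_closedBall (0 : EuclideanPlane) (n : ℝ))
        (isCompact_closedBall (0 : EuclideanPlane) (n : ℝ))).countable).mono ?_
    intro γ _
    obtain ⟨n, hn⟩ := exists_nat_ge ‖γ.1 0‖
    refine Set.mem_iUnion.2 ⟨n, ?_⟩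
    have hne : (((fun x => γ • x) '' Metric.closedBall (0 : EuclideanPlane) (n : ℝ)) ∩
        Metric.closedBall (0 : EuclideanPlane) (n : ℝ)).Nonempty :=
      ⟨γ.1 0, ⟨0, by simp, rfl⟩, by simpa using hn⟩
    exact hne
  obtain ⟨γ, y, hy⟩ := nonempty_interior_of_iUnion_of_closed
    (f := fun γ : X.group => {x : EuclideanPlane | γ.1 x = g x})
    (fun γ => isClosed_eq γ.1.continuous g.continuous)
    (Set.eq_univ_of_forall fun x => by
      obtain ⟨γ, hγ, h⟩ := hg x
      exact Set.mem_iUnion.2 ⟨⟨γ, hγ⟩, h⟩)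
  have key : γ.1.toRealAffineIsometryEquiv.toAffineEquiv.toAffineMap =
      g.toRealAffineIsometryEquiv.toAffineEquiv.toAffineMap := by
    refine AffineMap.ext_on (isOpen_interior.affineSpan_eq_top ⟨y, hy⟩) ?_
    intro x hx
    have := interior_subset hx
    simpa using this
  have : γ.1 = g := by
    ext1 x
    simpa using congrArg (fun f => f x) key
  exact this ▸ γ.2

end ClosedEuclideanTwoOrbifold

/-- The canonical homomorphism from a group to its profinite completion. -/
def toProfiniteCompletion (G : Type*) [Group G] :
    G →* ProfiniteGrp.ProfiniteCompletion.completion (GrpCat.of G) :=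
  (ProfiniteGrp.ProfiniteCompletion.eta (GrpCat.of G)).hom

/-! The translations in the group form a normal subgroup A of finite index, finitely generated and
torsion-free. Every normal subgroup of finite index contains some nA, so an element of the
completion is a coherent family t(n)g with one fixed g and with t(n) in A known modulo n. Let r be
the action of g on A by conjugation.

Part 1: suppose γ = (t(n)g) satisfies γ^m = 1, and put N = 1 + r + ⋯ + r^(m-1) and c = g^m, an
element of A. Then N t(n) + c lies in nA for all n. By `exists_norm_add_eq_zero_of_coherent` there
is an exact solution s that differs from each t(n) by an element of (1 - r)A + nA. Hence sg has
finite order, and since conjugation by v in A adds (1 - r)v to s, it is conjugate to γ in every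
finite quotient; compactness yields one conjugator. The arithmetic input is that m kills ker N / (1
- r)A, a first cohomology group of ℤ/m.

Part 2: after conjugating g inside G, h = ug with u in (1 - r)A + nA for all n. By Krull's
intersection theorem (1 - r)A is closed in the profinite topology, so u lies in it.

The geometric input is the finiteness of the point group, `finite_image_linearPart`: conjugates of
one nontrivial translation take finitely many values. Cocompactness enters only there, and the rank
of A plays no role. -/

open CategoryTheory

/-! ### Intersections of multiples in finitely generated abelian groups -/

/-- An element of a finitely generated abelian group that is divisible by every positive integer
vanishes. -/
theorem eq_zero_of_forall_exists_nsmul_eq {B : Type*} [AddCommGroup B] [Module.Finite ℤ B] {x : B}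
    (hx : ∀ n : ℕ, 0 < n → ∃ y, n • y = x) : x = 0 := by
  have key (d : ℕ) (hd : 0 < d) : ∃ r : Ideal.span {(d : ℤ)}, (r : ℤ) • x = x := by
    rw [← Ideal.mem_iInf_smul_pow_eq_bot_iff, Submodule.mem_iInf]
    intro i
    obtain ⟨y, rfl⟩ := hx (d ^ i) (by positivity)
    rw [Ideal.span_singleton_pow, ← Nat.cast_pow, ← natCast_zsmul]
    exact Submodule.smul_mem_smul (Ideal.mem_span_singleton_self _) trivial
  -- Here r is even, so r - 1 is nonzero and kills x. Applying `key` to |r - 1| makes x a multiple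
  -- of |r - 1| • x = 0.
  obtain ⟨r, hr⟩ := key 2 two_pos
  obtain ⟨k, hk⟩ := Ideal.mem_span_singleton.1 r.2
  have hd : (r - 1 : ℤ) • x = 0 := by rw [sub_smul, hr, one_smul, sub_self]
  have hd' : (r - 1 : ℤ).natAbs • x = 0 := by
    rcases Int.natAbs_eq (r - 1 : ℤ) with h | h
    · rw [← natCast_zsmul, ← h, hd]
    · rw [← natCast_zsmul, ← neg_eq_iff_eq_neg.2 h, neg_smul, hd, neg_zero]
  obtain ⟨r', hr'⟩ := key (r - 1 : ℤ).natAbs (by omega)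
  obtain ⟨l, hl⟩ := Ideal.mem_span_singleton.1 r'.2
  rw [← hr', hl, mul_comm, mul_smul, natCast_zsmul, hd', smul_zero]

/-- The range of an endomorphism of a finitely generated abelian group is closed in the profinite
topology. -/
theorem mem_range_of_forall_exists_add_nsmul {A : Type*} [AddCommGroup A] [Module.Finite ℤ A]
    (f : Module.End ℤ A) {u : A} (hu : ∀ n : ℕ, 0 < n → ∃ a b, u = f a + n • b) :
    ∃ a, f a = u := by
  have h : (LinearMap.range f).mkQ u = 0 := by
    refine eq_zero_of_forall_exists_nsmul_eq fun n hn => ?_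
    obtain ⟨a, b, rfl⟩ := hu n hn
    refine ⟨(LinearMap.range f).mkQ b, ?_⟩
    have : (LinearMap.range f).mkQ (f a) = 0 := by simp
    rw [map_add, this, zero_add, map_nsmul]
  simpa using h

/-- If `r` has order dividing `m`, then `m` annihilates the kernel of the norm element of `r`
modulo the range of `1 - r`. -/
theorem exists_sub_eq_nsmul_of_norm_eq_zero {A : Type*} [AddCommGroup A] (r : Module.End ℤ A)
    (m : ℕ) {z : A} (hz : (∑ i ∈ Finset.range m, r ^ i) z = 0) :
    ∃ v, m • z = v - r v := by
  have h (i : ℕ) : ∃ v, z - (r ^ i) z = v - r v := by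
    refine ⟨(∑ j ∈ Finset.range i, r ^ j) z, ?_⟩
    have := congrArg (fun f : Module.End ℤ A => f z) (mul_neg_geom_sum r i)
    simpa [sub_mul] using this.symm
  choose v hv using h
  refine ⟨∑ i ∈ Finset.range m, v i, ?_⟩
  rw [map_sum, ← Finset.sum_sub_distrib]
  simp_rw [← hv, Finset.sum_sub_distrib]
  rw [← LinearMap.sum_apply, hz]
  simp

/-- A coherent family of approximate solutions of `(1 + r + ⋯ + r ^ (m - 1)) s + c = 0` differs from
an exact solution by an approximate element of the range of `1 - r`. -/
theorem exists_norm_add_eq_zero_of_coherent {A : Type*} [AddCommGroup A] [Module.Finite ℤ A]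
    [IsAddTorsionFree A] (r : Module.End ℤ A) {m : ℕ} (hm : 0 < m) (hr : r ^ m = 1) {c : A}
    {t : ℕ → A} (ht : ∀ n k, 0 < n → 0 < k → n ∣ k → ∃ b, t k = t n + n • b)
    (hc : ∀ n, 0 < n → ∃ b, (∑ i ∈ Finset.range m, r ^ i) (t n) + c = n • b) :
    ∃ s, (∑ i ∈ Finset.range m, r ^ i) s + c = 0 ∧
      ∀ n, 0 < n → ∃ v w, t n = s + (v - r v) + n • w := by
  set N : Module.End ℤ A := ∑ i ∈ Finset.range m, r ^ i with hN
  have hrN (j : ℕ) : r ^ j * N = N := by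
    have h1 : r * N = N := by
      have := mul_geom_sum r m
      rw [hr, sub_self, sub_mul, one_mul, sub_eq_zero] at this
      exact this
    induction j with
    | zero => simp
    | succ j ih => rw [pow_succ, mul_assoc, h1, ih]
  have hNN (a : A) : N (N a) = m • N a := by
    have : N * N = m • N := by
      calc N * N = ∑ i ∈ Finset.range m, r ^ i * N := by rw [← Finset.sum_mul]
        _ = m • N := by simp_rw [hrN, Finset.sum_const, Finset.card_range]
    simpa using congrArg (fun f : Module.End ℤ A => f a) this
  obtain ⟨t₀, ht₀⟩ := mem_range_of_forall_exists_add_nsmul N (u := -c) fun n hn => by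
    obtain ⟨b, hb⟩ := hc n hn
    exact ⟨t n, -b, by rw [smul_neg, ← hb]; abel⟩
  -- an approximate zero of the norm is close to an exact one
  have approx (k : ℕ) (hk : 0 < k) : ∃ s y, N s = 0 ∧ t (m * k) - t₀ = s + k • y := by
    obtain ⟨x, hx⟩ := hc (m * k) (by positivity)
    have h1 : N (t (m * k) - t₀) = (m * k) • x := by rw [map_sub, ht₀, ← hx]; abel
    have h2 : m • x = N x := by
      have h3 : (m * k) • (m • x) = (m * k) • N x := by
        rw [← map_nsmul, ← h1, hNN, h1, smul_comm]
      exact nsmul_right_injective (by positivity) h3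
    -- Working at level m * k leaves room for the factor m in N x = m x: subtracting k x cancels N
    -- (t (m * k) - t₀) = m k x exactly.
    refine ⟨t (m * k) - t₀ - k • x, x, ?_, by abel⟩
    rw [map_sub, h1, map_nsmul, ← h2, mul_comm, mul_smul, sub_self]
  -- Precision m suffices to fix s: two elements of ker N that agree modulo m differ by m z with z
  -- in ker N, by torsion-freeness, hence by an element of (1 - r)A.
  obtain ⟨s, y, hs, hy⟩ := approx m hm
  refine ⟨s + t₀, by rw [map_add, hs, ht₀]; abel, fun n hn => ?_⟩
  obtain ⟨s', y', hs', hy'⟩ := approx (m * n) (by positivity)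
  obtain ⟨b, hb⟩ := ht (m * m) (m * (m * n)) (by positivity) (by positivity) ⟨n, by ring⟩
  obtain ⟨b', hb'⟩ := ht n (m * (m * n)) hn (by positivity) ⟨m * m, by ring⟩
  have hz : s' - s = m • (m • b + y - n • y') := by
    have e1 : s' = t (m * (m * n)) - t₀ - (m * n) • y' := by rw [hy']; abel
    have e2 : s = t (m * m) - t₀ - m • y := by rw [hy]; abel
    rw [e1, e2, hb, smul_sub, smul_add, mul_smul, mul_smul]
    abel
  have hNz : N (m • b + y - n • y') = 0 := by
    have : m • N (m • b + y - n • y') = m • 0 := by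
      rw [← map_nsmul, ← hz, map_sub, hs, hs', sub_zero, smul_zero]
    exact nsmul_right_injective hm.ne' this
  obtain ⟨v, hv⟩ := exists_sub_eq_nsmul_of_norm_eq_zero r m hNz
  refine ⟨v, m • y' - b', ?_⟩
  rw [← hv, ← hz, smul_sub, smul_comm n m, ← mul_smul]
  have e1 : t n = t (m * (m * n)) - n • b' := by rw [hb']; abel
  have e2 : t (m * (m * n)) = s' + (m * n) • y' + t₀ := by rw [← hy']; abel
  rw [e1, e2]
  abel

/-! ### The profinite completion -/

section Profinite

variable {G : Type*} [Group G]

/-- The projection of the profinite completion to a finite quotient. -/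
def profiniteCompletionProj (N : FiniteIndexNormalSubgroup G) :
    ProfiniteGrp.ProfiniteCompletion.completion (GrpCat.of G) →* G ⧸ N.toSubgroup where
  toFun x := x.1 N
  map_one' := rfl
  map_mul' _ _ := rfl

theorem profiniteCompletionProj_toProfiniteCompletion (N : FiniteIndexNormalSubgroup G) (g : G) :
    profiniteCompletionProj N (toProfiniteCompletion G g) = (g : G ⧸ N.toSubgroup) :=
  rfl

theorem profiniteCompletion_ext
    {x y : ProfiniteGrp.ProfiniteCompletion.completion (GrpCat.of G)}
    (h : ∀ N, profiniteCompletionProj N x = profiniteCompletionProj N y) : x = y :=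
  Subtype.ext (funext h)

theorem profiniteCompletionProj_eq_of_le {N M : FiniteIndexNormalSubgroup G} (h : N ≤ M)
    {x : ProfiniteGrp.ProfiniteCompletion.completion (GrpCat.of G)} {g : G}
    (hx : profiniteCompletionProj N x = (g : G ⧸ N.toSubgroup)) :
    profiniteCompletionProj M x = (g : G ⧸ M.toSubgroup) := by
  have h1 := x.2 (homOfLE h)
  have h2 := congrArg (QuotientGroup.map N.toSubgroup M.toSubgroup (MonoidHom.id G) h) hx
  exact h1.symm.trans h2

theorem exists_profiniteCompletionProj_eq (N : FiniteIndexNormalSubgroup G)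
    (x : ProfiniteGrp.ProfiniteCompletion.completion (GrpCat.of G)) :
    ∃ g : G, profiniteCompletionProj N x = (g : G ⧸ N.toSubgroup) :=
  (QuotientGroup.mk_surjective (profiniteCompletionProj N x)).imp fun _ h => h.symm

theorem isClosed_setOf_profiniteCompletionProj_eq (N : FiniteIndexNormalSubgroup G)
    (q : G ⧸ N.toSubgroup) :
    IsClosed {x : ProfiniteGrp.ProfiniteCompletion.completion (GrpCat.of G) |
      profiniteCompletionProj N x = q} := by
  let _ : TopologicalSpace (G ⧸ N.toSubgroup) := ⊥
  have : DiscreteTopology (G ⧸ N.toSubgroup) := ⟨rfl⟩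
  have hc : Continuous (profiniteCompletionProj N) :=
    (continuous_apply N).comp continuous_subtype_val
  exact isClosed_singleton.preimage hc

/-- Two elements of the profinite completion are conjugate if they are so in all finite
quotients. -/
theorem isConj_of_forall_isConj_proj
    {x y : ProfiniteGrp.ProfiniteCompletion.completion (GrpCat.of G)}
    (h : ∀ N, IsConj (profiniteCompletionProj N x) (profiniteCompletionProj N y)) :
    IsConj x y := by
  -- The conjugators that work modulo N form a directed family of nonempty closed sets in a compact
  -- group.
  let C (N : FiniteIndexNormalSubgroup G) :
      Set (ProfiniteGrp.ProfiniteCompletion.completion (GrpCat.of G)) :=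
    {c | profiniteCompletionProj N (c * x * c⁻¹ * y⁻¹) = 1}
  have hC (N) : IsClosed (C N) :=
    (isClosed_setOf_profiniteCompletionProj_eq N 1).preimage
      (f := fun c => c * x * c⁻¹ * y⁻¹) (by fun_prop)
  have hne (N) : (C N).Nonempty := by
    obtain ⟨c, hc⟩ := isConj_iff.1 (h N)
    obtain ⟨g, rfl⟩ := QuotientGroup.mk_surjective c
    refine ⟨toProfiniteCompletion G g, ?_⟩
    change profiniteCompletionProj N _ = 1
    rw [map_mul, map_mul, map_mul, map_inv, map_inv,
      profiniteCompletionProj_toProfiniteCompletion, hc, mul_inv_cancel]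
  have hmono {N M : FiniteIndexNormalSubgroup G} (hNM : N ≤ M) : C N ⊆ C M := fun c hc => by
    have := profiniteCompletionProj_eq_of_le hNM (g := 1) (hc.trans (QuotientGroup.mk_one _).symm)
    exact this.trans (QuotientGroup.mk_one _)
  have : Nonempty (FiniteIndexNormalSubgroup G) := ⟨FiniteIndexNormalSubgroup.ofSubgroup ⊤⟩
  obtain ⟨c, hc⟩ := IsCompact.nonempty_iInter_of_directed_nonempty_isCompact_isClosed C
    (fun N M => ⟨N ⊓ M, hmono inf_le_left, hmono inf_le_right⟩) hne (fun N => (hC N).isCompact) hC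
  refine isConj_iff.2 ⟨c, ?_⟩
  rw [← mul_inv_eq_one]
  refine profiniteCompletion_ext fun N => ?_
  rw [map_one]
  exact Set.mem_iInter.1 hc N

end Profinite

/-! ### Extensions of finite groups by finitely generated free abelian groups -/

section VirtuallyAbelian

variable {G : Type*} [Group G] {A : Type*} [AddCommGroup A]

/-- The image in `G` of the `n`-th multiples in an abelian group mapping to `G`. -/
def multiplesSubgroup (τ : Multiplicative A →* G) (n : ℕ) : Subgroup G :=
  (τ.comp (powMonoidHom n)).range

variable {τ : Multiplicative A →* G}

theorem mem_multiplesSubgroup {n : ℕ} {g : G} :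
    g ∈ multiplesSubgroup τ n ↔ ∃ a : A, τ (.ofAdd (n • a)) = g :=
  Iff.rfl

theorem multiplesSubgroup_le_of_dvd {n k : ℕ} (h : n ∣ k) :
    multiplesSubgroup τ k ≤ multiplesSubgroup τ n := by
  rintro _ ⟨a, rfl⟩
  obtain ⟨l, rfl⟩ := h
  exact ⟨a ^ l, by simp [← pow_mul, mul_comm]⟩

/-- A/nA is finitely generated and torsion, hence finite. -/
theorem finiteIndex_range_powMonoidHom [Module.Finite ℤ A] {n : ℕ} (hn : 0 < n) :
    (powMonoidHom n : Multiplicative A →* Multiplicative A).range.FiniteIndex := by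
  have hfin : Finite (A ⧸ LinearMap.range (LinearMap.lsmul ℤ A n)) := by
    refine Module.finite_of_fg_torsion _ fun {x} => ?_
    obtain ⟨a, rfl⟩ := Submodule.mkQ_surjective (LinearMap.range (LinearMap.lsmul ℤ A (n : ℤ))) x
    refine ⟨⟨n, mem_nonZeroDivisors_of_ne_zero (by positivity)⟩, ?_⟩
    change (n : ℤ) • (LinearMap.range (LinearMap.lsmul ℤ A (n : ℤ))).mkQ a = 0
    rw [← map_smul, Submodule.mkQ_apply, Submodule.Quotient.mk_eq_zero]
    exact ⟨a, rfl⟩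
  have h : (LinearMap.range (LinearMap.lsmul ℤ A n)).toAddSubgroup.FiniteIndex :=
    @AddSubgroup.finiteIndex_of_finite_quotient _ _ _ hfin
  have h' : (AddSubgroup.toSubgroup
    (LinearMap.range (LinearMap.lsmul ℤ A n)).toAddSubgroup).FiniteIndex := ⟨h.1⟩
  convert h' using 1
  ext x
  constructor
  · rintro ⟨y, rfl⟩
    exact ⟨y.toAdd, natCast_zsmul _ _⟩
  · rintro ⟨y, hy⟩
    exact ⟨.ofAdd y, (natCast_zsmul y n).symm.trans hy⟩

theorem finiteIndex_multiplesSubgroup [Module.Finite ℤ A] [hT : τ.range.FiniteIndex] {n : ℕ}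
    (hn : 0 < n) : (multiplesSubgroup τ n).FiniteIndex := by
  have h := finiteIndex_range_powMonoidHom (A := A) hn
  have h' : ((powMonoidHom n : Multiplicative A →* Multiplicative A).range ⊔ τ.ker).FiniteIndex :=
    Subgroup.finiteIndex_of_le le_sup_left
  refine ⟨?_⟩
  rw [multiplesSubgroup, MonoidHom.range_comp, Subgroup.index_map]
  exact mul_ne_zero h'.index_ne_zero hT.index_ne_zero

variable {ρ : G → Module.End ℤ A}

theorem normal_multiplesSubgroup (hρ : ∀ g a, g * τ (.ofAdd a) * g⁻¹ = τ (.ofAdd (ρ g a)))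
    (n : ℕ) : (multiplesSubgroup τ n).Normal := by
  refine ⟨fun x hx g => ?_⟩
  obtain ⟨a, rfl⟩ := mem_multiplesSubgroup.1 hx
  exact mem_multiplesSubgroup.2 ⟨ρ g a, by rw [hρ, map_nsmul (ρ g)]⟩

theorem mul_map_ofAdd (hρ : ∀ g a, g * τ (.ofAdd a) * g⁻¹ = τ (.ofAdd (ρ g a))) (g : G) (a : A) :
    g * τ (.ofAdd a) = τ (.ofAdd (ρ g a)) * g := by
  rw [← hρ, inv_mul_cancel_right]

/-- This turns the torsion condition on an element of the coset of g into a linear equation in A. -/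
theorem map_ofAdd_mul_pow (hρ : ∀ g a, g * τ (.ofAdd a) * g⁻¹ = τ (.ofAdd (ρ g a))) (g : G)
    (a : A) (m : ℕ) :
    (τ (.ofAdd a) * g) ^ m = τ (.ofAdd ((∑ i ∈ Finset.range m, ρ g ^ i) a)) * g ^ m := by
  induction m with
  | zero => simp
  | succ m ih =>
    rw [pow_succ', ih, Finset.sum_range_succ', ← mul_assoc, mul_assoc (τ _), mul_map_ofAdd hρ,
      ← mul_assoc, ← map_mul, mul_assoc, ← pow_succ', ← ofAdd_add]
    congr 3
    rw [pow_zero, add_comm]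
    simp [pow_succ', map_sum]

/-- A is commutative, so its own elements act trivially on it by conjugation. -/
theorem pow_action_eq_one (hτ : Function.Injective τ)
    (hρ : ∀ g a, g * τ (.ofAdd a) * g⁻¹ = τ (.ofAdd (ρ g a))) {g : G} {m : ℕ}
    (hg : g ^ m ∈ τ.range) : ρ g ^ m = 1 := by
  ext a
  have key (j : ℕ) : g ^ j * τ (.ofAdd a) = τ (.ofAdd ((ρ g ^ j) a)) * g ^ j := by
    induction j with
    | zero => simp
    | succ j ih =>
      rw [pow_succ', mul_assoc, ih, ← mul_assoc, mul_map_ofAdd hρ, mul_assoc, ← pow_succ',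
        pow_succ' (ρ g)]
      rfl
  obtain ⟨b, hb⟩ := hg
  have h := key m
  rw [← hb, ← map_mul, mul_comm, map_mul, mul_left_inj] at h
  exact (Multiplicative.ofAdd.injective (hτ h)).symm

/-- The multiples of `n` as a finite index normal subgroup; these are cofinal in the
profinite topology. -/
noncomputable def multiplesFiniteIndexNormalSubgroup [Module.Finite ℤ A] [τ.range.FiniteIndex]
    (hρ : ∀ g a, g * τ (.ofAdd a) * g⁻¹ = τ (.ofAdd (ρ g a))) {n : ℕ} (hn : 0 < n) :
    FiniteIndexNormalSubgroup G where
  toSubgroup := multiplesSubgroup τ n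
  isNormal' := normal_multiplesSubgroup hρ n
  isFiniteIndex' := finiteIndex_multiplesSubgroup hn

theorem exists_multiplesSubgroup_le (N : Subgroup G) [N.Normal] [N.FiniteIndex] :
    ∃ n, 0 < n ∧ multiplesSubgroup τ n ≤ N := by
  refine ⟨N.index, Nat.pos_of_ne_zero Subgroup.FiniteIndex.index_ne_zero, ?_⟩
  rintro _ ⟨a, rfl⟩
  simpa using N.pow_index_mem (τ a)

variable [Module.Finite ℤ A] [τ.range.FiniteIndex]

/-- An element of the profinite completion is a coherent family of translates of some `g : G`. -/
theorem exists_profiniteCompletionProj_family (hτ : Function.Injective τ)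
    (hρ : ∀ g a, g * τ (.ofAdd a) * g⁻¹ = τ (.ofAdd (ρ g a)))
    (x : ProfiniteGrp.ProfiniteCompletion.completion (GrpCat.of G)) :
    ∃ (g : G) (t : ℕ → A),
      (∀ n, (hn : 0 < n) →
        profiniteCompletionProj (multiplesFiniteIndexNormalSubgroup hρ hn) x =
          QuotientGroup.mk (τ (.ofAdd (t n)) * g)) ∧
      ∀ n k, 0 < n → 0 < k → n ∣ k → ∃ b, t k = t n + n • b := by
  -- Level 1 is the quotient by the image of A; its coset provides one g for all levels.
  obtain ⟨g, hg⟩ := exists_profiniteCompletionProj_eq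
    (multiplesFiniteIndexNormalSubgroup hρ one_pos) x
  have h (n : ℕ) : ∃ a : A, ∀ hn : 0 < n,
      profiniteCompletionProj (multiplesFiniteIndexNormalSubgroup hρ hn) x =
        QuotientGroup.mk (τ (.ofAdd a) * g) := by
    rcases Nat.eq_zero_or_pos n with rfl | hn
    · exact ⟨0, fun h => absurd h (lt_irrefl _)⟩
    obtain ⟨g', hg'⟩ := exists_profiniteCompletionProj_eq
      (multiplesFiniteIndexNormalSubgroup hρ hn) x
    have h1 := (profiniteCompletionProj_eq_of_le (M := multiplesFiniteIndexNormalSubgroup hρ one_pos)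
      (multiplesSubgroup_le_of_dvd (one_dvd n)) hg').symm.trans hg
    have h2 : g' / g ∈ multiplesSubgroup τ 1 := by
      have := normal_multiplesSubgroup hρ 1
      exact QuotientGroup.eq_iff_div_mem.1 h1
    obtain ⟨a, ha⟩ := mem_multiplesSubgroup.1 h2
    refine ⟨a, fun _ => hg'.trans ?_⟩
    rw [one_smul] at ha
    rw [ha, div_mul_cancel]
  choose t ht using h
  refine ⟨g, t, ht, fun n k hn hk hnk => ?_⟩
  have h1 := (profiniteCompletionProj_eq_of_le (M := multiplesFiniteIndexNormalSubgroup hρ hn)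
    (multiplesSubgroup_le_of_dvd hnk) (ht k hk)).symm.trans (ht n hn)
  have h2 : (τ (.ofAdd (t k)) * g) / (τ (.ofAdd (t n)) * g) ∈ multiplesSubgroup τ n := by
    have := normal_multiplesSubgroup hρ n
    exact QuotientGroup.eq_iff_div_mem.1 h1
  obtain ⟨b, hb⟩ := mem_multiplesSubgroup.1 h2
  refine ⟨b, ?_⟩
  rw [mul_div_mul_right_eq_div, ← map_div, ← ofAdd_sub] at hb
  rw [Multiplicative.ofAdd.injective (hτ hb)]
  abel

theorem exists_isOfFinOrder_isConj_toProfiniteCompletion [IsAddTorsionFree A]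
    (hτ : Function.Injective τ) (hρ : ∀ g a, g * τ (.ofAdd a) * g⁻¹ = τ (.ofAdd (ρ g a)))
    {γ : ProfiniteGrp.ProfiniteCompletion.completion (GrpCat.of G)} (hγ : IsOfFinOrder γ) :
    ∃ g : G, IsOfFinOrder g ∧ IsConj (toProfiniteCompletion G g) γ := by
  obtain ⟨m, hm, hγm⟩ := isOfFinOrder_iff_pow_eq_one.1 hγ
  obtain ⟨g, t, ht, htc⟩ := exists_profiniteCompletionProj_family hτ hρ γ
  have hpow (n : ℕ) (hn : 0 < n) : ∃ b, (τ (.ofAdd (t n)) * g) ^ m = τ (.ofAdd (n • b)) := by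
    have h := congrArg (fun x => x ^ m) (ht n hn)
    simp only [← map_pow, hγm, map_one] at h
    have h' : (τ (.ofAdd (t n)) * g) ^ m ∈ multiplesSubgroup τ n := by
      have := normal_multiplesSubgroup hρ n
      exact (QuotientGroup.eq_one_iff _).1 h.symm
    obtain ⟨b, hb⟩ := mem_multiplesSubgroup.1 h'
    exact ⟨b, hb.symm⟩
  have hgm : ∃ c, g ^ m = τ (.ofAdd c) := by
    obtain ⟨b, hb⟩ := hpow 1 one_pos
    rw [map_ofAdd_mul_pow hρ] at hb
    refine ⟨-(∑ i ∈ Finset.range m, ρ g ^ i) (t 1) + 1 • b, ?_⟩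
    rw [ofAdd_add, map_mul, ← hb, ofAdd_neg, map_inv, inv_mul_cancel_left]
  obtain ⟨c, hc⟩ := hgm
  obtain ⟨s, hs, hst⟩ := exists_norm_add_eq_zero_of_coherent (ρ g) hm
    (pow_action_eq_one hτ hρ (hc ▸ ⟨_, rfl⟩)) (c := c) htc fun n hn => by
      obtain ⟨b, hb⟩ := hpow n hn
      rw [map_ofAdd_mul_pow hρ, hc, ← map_mul, ← ofAdd_add] at hb
      exact ⟨b, Multiplicative.ofAdd.injective (hτ hb)⟩
  refine ⟨τ (.ofAdd s) * g, isOfFinOrder_iff_pow_eq_one.2 ⟨m, hm, ?_⟩, ?_⟩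
  · rw [map_ofAdd_mul_pow hρ, hc, ← map_mul, ← ofAdd_add, hs, ofAdd_zero, map_one]
  refine isConj_of_forall_isConj_proj fun N => ?_
  obtain ⟨n, hn, hnN⟩ := exists_multiplesSubgroup_le (τ := τ) N.toSubgroup
  obtain ⟨v, w, hvw⟩ := hst n hn
  rw [profiniteCompletionProj_eq_of_le (M := N) hnN (ht n hn),
    profiniteCompletionProj_toProfiniteCompletion, isConj_iff]
  -- Conjugation by v replaces s by s + (v - ρ g v), which is t n up to n w.
  refine ⟨QuotientGroup.mk (τ (.ofAdd v)), ?_⟩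
  rw [← QuotientGroup.mk_inv, ← QuotientGroup.mk_mul, ← QuotientGroup.mk_mul]
  refine QuotientGroup.eq_iff_div_mem.2 (hnN (mem_multiplesSubgroup.2 ⟨-w, ?_⟩))
  rw [← map_inv, ← ofAdd_neg, mul_assoc (τ _), mul_assoc (τ (.ofAdd s)), mul_map_ofAdd hρ,
    ← mul_assoc, ← mul_assoc, mul_div_mul_right_eq_div, ← map_mul, ← map_mul, ← map_div,
    ← ofAdd_add, ← ofAdd_add, ← ofAdd_sub, hvw, map_neg, smul_neg]
  congr 2
  abel

theorem isConj_of_isConj_toProfiniteCompletion (hτ : Function.Injective τ)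
    (hρ : ∀ g a, g * τ (.ofAdd a) * g⁻¹ = τ (.ofAdd (ρ g a))) {g h : G}
    (hgh : IsConj (toProfiniteCompletion G g) (toProfiniteCompletion G h)) : IsConj g h := by
  obtain ⟨x, hx⟩ := isConj_iff.1 hgh
  obtain ⟨k, t, ht, -⟩ := exists_profiniteCompletionProj_family hτ hρ x
  set g' := k * g * k⁻¹ with hg'
  have key (n : ℕ) (hn : 0 < n) :
      ∃ b, τ (.ofAdd (t n)) * g' * (τ (.ofAdd (t n)))⁻¹ = τ (.ofAdd (n • b)) * h := by
    have h1 := congrArg (profiniteCompletionProj (multiplesFiniteIndexNormalSubgroup hρ hn)) hx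
    rw [map_mul, map_mul, map_inv, ht n hn, profiniteCompletionProj_toProfiniteCompletion,
      profiniteCompletionProj_toProfiniteCompletion, ← QuotientGroup.mk_inv,
      ← QuotientGroup.mk_mul, ← QuotientGroup.mk_mul] at h1
    have := normal_multiplesSubgroup hρ n
    obtain ⟨b, hb⟩ := mem_multiplesSubgroup.1 (QuotientGroup.eq_iff_div_mem.1 h1)
    refine ⟨b, ?_⟩
    rw [hb, hg', div_mul_cancel]
    group
  have key' (n : ℕ) (hn : 0 < n) :
      ∃ b, τ (.ofAdd (t n - ρ g' (t n) - n • b)) * g' = h := by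
    obtain ⟨b, hb⟩ := key n hn
    refine ⟨b, ?_⟩
    rw [mul_assoc, ← map_inv, ← ofAdd_neg, mul_map_ofAdd hρ, ← mul_assoc, ← map_mul,
      ← ofAdd_add] at hb
    rw [ofAdd_sub, div_eq_inv_mul, map_mul, map_inv, mul_assoc, sub_eq_add_neg, ← map_neg, hb,
      inv_mul_cancel_left]
  obtain ⟨b₁, hb₁⟩ := key' 1 one_pos
  -- The element u with τ(u) g' = h does not depend on n, so every level n exhibits the same u in (1
  -- - ρ g')A + nA.
  obtain ⟨a, ha⟩ := mem_range_of_forall_exists_add_nsmul (1 - ρ g')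
    (u := t 1 - ρ g' (t 1) - 1 • b₁) fun n hn => by
      obtain ⟨b, hb⟩ := key' n hn
      refine ⟨t n, -b, ?_⟩
      rw [← hb, mul_left_inj] at hb₁
      rw [Multiplicative.ofAdd.injective (hτ hb₁)]
      simp [sub_eq_add_neg]
  have : IsConj g' h := by
    refine isConj_iff.2 ⟨τ (.ofAdd a), ?_⟩
    rw [← hb₁, ← ha, mul_assoc, ← map_inv, ← ofAdd_neg, mul_map_ofAdd hρ, ← mul_assoc, ← map_mul,
      ← ofAdd_add, map_neg]
    simp [sub_eq_add_neg]
  exact (isConj_iff.2 ⟨k, rfl⟩ : IsConj g g').trans this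

end VirtuallyAbelian

open Metric

/-! ### Plane isometries and their linear parts -/

namespace EuclideanPlane

/-- The identification of the Euclidean plane with the complex numbers. -/
noncomputable def toComplex : EuclideanPlane ≃ₗᵢ[ℝ] ℂ :=
  Complex.orthonormalBasisOneI.repr.symm

theorem apply_add (g : EuclideanPlane ≃ᵢ EuclideanPlane) (v x : EuclideanPlane) :
    g (v + x) = g.toRealAffineIsometryEquiv.linearIsometryEquiv v + g x := by
  simpa using g.toRealAffineIsometryEquiv.map_vadd x v

/-- The linear part of an isometry of the plane, as an isometry of the complex numbers. -/
noncomputable def linearPart : (EuclideanPlane ≃ᵢ EuclideanPlane) →* (ℂ ≃ₗᵢ[ℝ] ℂ) where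
  toFun g :=
    toComplex.symm.trans (g.toRealAffineIsometryEquiv.linearIsometryEquiv.trans toComplex)
  map_one' := by
    ext z
    have h := apply_add 1 (toComplex.symm z) 0
    change toComplex.symm z + 0 = _ + 0 at h
    rw [add_left_inj] at h
    simp [← h]
  map_mul' g h := by
    ext z
    have h1 := apply_add (g * h) (toComplex.symm z) 0
    rw [IsometryEquiv.mul_apply, IsometryEquiv.mul_apply, apply_add h, apply_add g,
      add_left_inj] at h1
    simp [← h1]

theorem toComplex_apply (g : EuclideanPlane ≃ᵢ EuclideanPlane) (x : EuclideanPlane) :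
    toComplex (g x) = linearPart g (toComplex x) + toComplex (g 0) := by
  have h := apply_add g x 0
  rw [add_zero] at h
  simp [h, linearPart]

theorem apply_eq_add_of_linearPart_eq_one {g : EuclideanPlane ≃ᵢ EuclideanPlane}
    (hg : linearPart g = 1) (x : EuclideanPlane) : g x = x + g 0 := by
  apply toComplex.injective
  rw [toComplex_apply, hg, map_add]
  rfl

theorem toComplex_conj_apply_zero {c : EuclideanPlane ≃ᵢ EuclideanPlane}
    (hc : linearPart c = 1) (g : EuclideanPlane ≃ᵢ EuclideanPlane) :
    toComplex ((g * c * g⁻¹) 0) = linearPart g (toComplex (c 0)) := by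
  have h : (g * c * g⁻¹) 0 = g (c (g⁻¹ 0)) := rfl
  have h0 : toComplex (g (g⁻¹ 0)) = 0 := by rw [IsometryEquiv.apply_inv_self, map_zero]
  rw [toComplex_apply] at h0
  rw [h, apply_eq_add_of_linearPart_eq_one hc, toComplex_apply, map_add, map_add,
    add_right_comm, h0, zero_add]

end EuclideanPlane

theorem mul_inv_mem_range_rotation {f f' : ℂ ≃ₗᵢ[ℝ] ℂ} (hf : f ∉ rotation.range)
    (hf' : f' ∉ rotation.range) : f * f'⁻¹ ∈ rotation.range := by
  obtain ⟨a, rfl | rfl⟩ := linear_isometry_complex f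
  · exact absurd ⟨a, rfl⟩ hf
  obtain ⟨b, rfl | rfl⟩ := linear_isometry_complex f'
  · exact absurd ⟨b, rfl⟩ hf'
  change (rotation a * Complex.conjLIE) * (rotation b * Complex.conjLIE)⁻¹ ∈ _
  refine ⟨a * b⁻¹, ?_⟩
  rw [map_mul, map_inv]
  group

theorem Circle.im_ne_zero {a : Circle} (h1 : a ≠ 1) (h2 : a ≠ -1) : (a : ℂ).im ≠ 0 := by
  intro h
  have hn := Circle.normSq_coe a
  rw [Complex.normSq_apply, h, mul_zero, add_zero, mul_self_eq_one_iff] at hn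
  rcases hn with hn | hn
  · exact h1 (Circle.ext (Complex.ext hn h))
  · exact h2 (Circle.ext (Complex.ext (by simpa using hn) (by simpa using h)))

/-- A linear isometry of the complex numbers is determined by its values on a nonzero vector and
on a rotated copy of it. -/
theorem injective_eval_rotation {a : Circle} (h1 : a ≠ 1) (h2 : a ≠ -1) {w : ℂ} (hw : w ≠ 0) :
    Function.Injective fun f : ℂ ≃ₗᵢ[ℝ] ℂ => (f w, f (a * w)) := by
  intro f f' h
  simp only [Prod.mk.injEq] at h
  ext z
  have him := Circle.im_ne_zero h1 h2
  obtain ⟨x, y, hxy⟩ : ∃ x y : ℝ, z = x • w + y • (a * w) := by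
    refine ⟨(z / w).re - (z / w).im / (a : ℂ).im * (a : ℂ).re, (z / w).im / (a : ℂ).im, ?_⟩
    have key : z / w = (((z / w).re - (z / w).im / (a : ℂ).im * (a : ℂ).re : ℝ) : ℂ) +
        (((z / w).im / (a : ℂ).im : ℝ) : ℂ) * a := by
      apply Complex.ext
      · simp
      · simp [him]
    rw [div_eq_iff hw] at key
    rw [Complex.real_smul, Complex.real_smul]
    conv_lhs => rw [key]
    ring
  rw [hxy, map_add, map_add, map_smul, map_smul, map_smul, map_smul, h.1, h.2]

/-! ### Finiteness of the point group and the translation lattice -/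

namespace ClosedEuclideanTwoOrbifold

open EuclideanPlane

variable (X : ClosedEuclideanTwoOrbifold)

theorem finite_setOf_norm_apply_zero_le (R : ℝ) :
    {g : EuclideanPlane ≃ᵢ EuclideanPlane | g ∈ X.group ∧ ‖g 0‖ ≤ R}.Finite := by
  have hpd := X.properlyDiscontinuous
  have h := hpd.finite_disjoint_inter_image (isCompact_closedBall (0 : EuclideanPlane) R)
    (isCompact_closedBall (0 : EuclideanPlane) R)
  refine (h.image Subtype.val).subset ?_
  rintro g ⟨hg, hgR⟩
  refine ⟨⟨g, hg⟩, ?_, rfl⟩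
  have hne : (((fun x => (⟨g, hg⟩ : X.group) • x) '' closedBall (0 : EuclideanPlane) R) ∩
      closedBall (0 : EuclideanPlane) R).Nonempty :=
    ⟨g 0, ⟨0, by simpa using (norm_nonneg _).trans hgR, rfl⟩, by simpa using hgR⟩
  exact hne

/-- Every point is within bounded distance of a given orbit. -/
theorem exists_forall_exists_dist_lt (p : EuclideanPlane) :
    ∃ R : ℝ, ∀ x, ∃ g ∈ X.group, dist x (g p) < R := by
  have hc := X.compact
  have : ContinuousConstSMul X.group EuclideanPlane := ⟨fun g => g.1.continuous⟩
  have hopen : IsOpenMap X.covering := isOpenMap_quotient_mk'_mul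
  obtain ⟨n, hn⟩ := isCompact_univ.elim_directed_cover
    (fun n : ℕ => X.covering '' ball p n) (fun n => hopen _ isOpen_ball)
    (fun q _ => by
      obtain ⟨x, rfl⟩ := Quotient.mk_surjective q
      obtain ⟨n, hn⟩ := exists_nat_gt (dist x p)
      exact Set.mem_iUnion.2 ⟨n, x, hn, rfl⟩)
    (directed_of_isDirected_le fun n k hnk =>
      Set.image_mono (ball_subset_ball (by exact_mod_cast hnk)))
  refine ⟨n, fun x => ?_⟩
  obtain ⟨y, hy, hyx⟩ := hn (Set.mem_univ (X.covering x))
  obtain ⟨g, hg⟩ := MulAction.orbitRel_apply.1 (Quotient.exact hyx.symm)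
  have hg' : g.1 y = x := hg
  refine ⟨g.1, g.2, ?_⟩
  rw [← hg', g.1.isometry.dist_eq]
  exact hy

/-- If the group contains a rotation, then some orientation-preserving element does not commute
with it. -/
theorem exists_not_commute {g : EuclideanPlane ≃ᵢ EuclideanPlane} {a : Circle}
    (ha : linearPart g = rotation a) (ha1 : a ≠ 1) :
    ∃ h ∈ X.group, linearPart h ∈ rotation.range ∧ g * h ≠ h * g := by
  -- Otherwise all orientation-preserving elements fix the unique fixed point p of g. The orbit of p
  -- then has at most two points, and the plane would be bounded.
  by_contra! hcomm
  have ha1' : (1 - a : ℂ) ≠ 0 := fun h => ha1 (Circle.ext (sub_eq_zero.1 h).symm)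
  have hfix (x : EuclideanPlane) : g x = x ↔ toComplex x = toComplex (g 0) / (1 - a) := by
    rw [← toComplex.injective.eq_iff, toComplex_apply, ha, rotation_apply, eq_div_iff ha1']
    constructor <;> intro h
    · linear_combination -h
    · linear_combination -h
  set p : EuclideanPlane := toComplex.symm (toComplex (g 0) / (1 - a)) with hp
  have hgp : g p = p := (hfix p).2 (by simp [hp])
  have hfixed (h) (hh : h ∈ X.group) (hr : linearPart h ∈ rotation.range) : h p = p := by
    have h1 : g (h p) = h p := by
      have := DFunLike.congr_fun (hcomm h hh hr) p
      exact this.trans (congrArg h hgp)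
    exact toComplex.injective (((hfix _).1 h1).trans ((hfix p).1 hgp).symm)
  -- Any two orientation-reversing elements differ by an orientation-preserving one, so they send p
  -- to the same point.
  obtain ⟨q, hq⟩ : ∃ q, ∀ h ∈ X.group, h p = p ∨ h p = q := by
    by_cases hall : ∀ h ∈ X.group, linearPart h ∈ rotation.range
    · exact ⟨p, fun h hh => Or.inl (hfixed h hh (hall h hh))⟩
    push Not at hall
    obtain ⟨h₀, hh₀, hr₀⟩ := hall
    refine ⟨h₀ p, fun h hh => ?_⟩
    by_cases hr : linearPart h ∈ rotation.range
    · exact Or.inl (hfixed h hh hr)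
    right
    have hr' : linearPart (h₀⁻¹ * h) ∈ rotation.range := by
      have h1 : (linearPart h₀)⁻¹ ∉ rotation.range := fun h => hr₀ (by simpa using inv_mem h)
      have h2 : (linearPart h)⁻¹ ∉ rotation.range := fun h => hr (by simpa using inv_mem h)
      simpa using mul_inv_mem_range_rotation h1 h2
    have h1 := hfixed _ (mul_mem (inv_mem hh₀) hh) hr'
    have h2 := congrArg h₀ h1
    rwa [IsometryEquiv.mul_apply, IsometryEquiv.apply_inv_self] at h2
  obtain ⟨R, hR⟩ := X.exists_forall_exists_dist_lt p
  have hb : Bornology.IsBounded (Set.univ : Set EuclideanPlane) := by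
    refine (isBounded_ball (x := p) (r := R)).union (isBounded_ball (x := q) (r := R)) |>.subset ?_
    intro x _
    obtain ⟨h, hh, hd⟩ := hR x
    rcases hq h hh with h' | h' <;> rw [h'] at hd
    · exact Or.inl hd
    · exact Or.inr hd
  exact NormedSpace.unbounded_univ ℝ EuclideanPlane hb

/-- The point group is finite. -/
theorem finite_image_linearPart : (linearPart '' (X.group : Set _)).Finite := by
  -- If only the rotations ±1 occur, the orientation-reversing linear parts lie in a single coset of
  -- them, and finiteness is immediate.
  by_cases hA : ∀ g ∈ X.group, ∀ a, linearPart g = rotation a → a = 1 ∨ a = -1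
  · set S : Set (ℂ ≃ₗᵢ[ℝ] ℂ) := {rotation 1, rotation (-1)}
    have hS : S.Finite := Set.toFinite _
    have hmem (g) (hg : g ∈ X.group) (hr : linearPart g ∈ rotation.range) : linearPart g ∈ S := by
      obtain ⟨a, ha⟩ := hr
      rw [← ha]
      rcases hA g hg a ha.symm with rfl | rfl
      · exact Or.inl rfl
      · exact Or.inr rfl
    by_cases hall : ∀ g ∈ X.group, linearPart g ∈ rotation.range
    · exact hS.subset (Set.image_subset_iff.2 fun g hg => hmem g hg (hall g hg))
    push Not at hall
    obtain ⟨h, hh, hr⟩ := hall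
    refine (hS.union (hS.image (· * linearPart h))).subset (Set.image_subset_iff.2 fun g hg => ?_)
    by_cases hg' : linearPart g ∈ rotation.range
    · exact Or.inl (hmem g hg hg')
    · refine Or.inr ⟨linearPart (g * h⁻¹), hmem _ (mul_mem hg (inv_mem hh)) ?_, by simp⟩
      rw [map_mul, map_inv]
      exact mul_inv_mem_range_rotation hg' hr
  push Not at hA
  obtain ⟨g, hg, a, ha, ha1, ha2⟩ := hA
  obtain ⟨h, hh, ⟨b, hb⟩, hgh⟩ := X.exists_not_commute ha ha1
  -- Plane rotations commute, so this commutator is a translation, and it is nontrivial because g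
  -- and h do not commute.
  set c := g * h * g⁻¹ * h⁻¹ with hc
  have hcX : c ∈ X.group := mul_mem (mul_mem (mul_mem hg hh) (inv_mem hg)) (inv_mem hh)
  have hLc : linearPart c = 1 := by
    simp only [hc, map_mul, map_inv, ha, ← hb]
    rw [← map_mul, mul_comm, map_mul]
    group
  have hw : toComplex (c 0) ≠ 0 := by
    intro h0
    have hc0 : c 0 = 0 := toComplex.injective (h0.trans (map_zero _).symm)
    have hc1 : c = 1 := by
      ext1 x
      rw [apply_eq_add_of_linearPart_eq_one hLc, hc0, add_zero]
      rfl
    rw [hc, mul_inv_eq_one, mul_inv_eq_iff_eq_mul] at hc1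
    exact hgh hc1
  set V : Set ℂ := (fun f : EuclideanPlane ≃ᵢ EuclideanPlane => toComplex (f 0)) ''
    {f | f ∈ X.group ∧ ‖f 0‖ ≤ ‖c 0‖}
  have hV : V.Finite := (X.finite_setOf_norm_apply_zero_le _).image _
  have hmem (f) (hf : f ∈ X.group) : linearPart f (toComplex (c 0)) ∈ V := by
    refine ⟨f * c * f⁻¹, ⟨mul_mem (mul_mem hf hcX) (inv_mem hf), ?_⟩,
      toComplex_conj_apply_zero hLc f⟩
    rw [← toComplex.norm_map, toComplex_conj_apply_zero hLc, LinearIsometryEquiv.norm_map,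
      LinearIsometryEquiv.norm_map]
  -- With w the vector of c, the linear part L of f is determined by L w and L(a w). Both lie in V,
  -- since L(a w) is the image of w under the linear part of f * g.
  refine Set.Finite.of_finite_image ?_ (injective_eval_rotation ha1 ha2 hw).injOn
  refine (hV.prod hV).subset ?_
  rintro _ ⟨_, ⟨f, hf, rfl⟩, rfl⟩
  refine ⟨hmem f hf, ?_⟩
  have := hmem (f * g) (mul_mem hf hg)
  rw [map_mul, ha] at this
  exact this

/-- The lattice of translations in the group of the orbifold. -/
def translationLattice : Submodule ℤ EuclideanPlane :=
  AddSubgroup.toIntSubmodule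
    { carrier := {v | IsometryEquiv.addRight v ∈ X.group}
      zero_mem' := by
        have h : (IsometryEquiv.addRight 0 : EuclideanPlane ≃ᵢ EuclideanPlane) = 1 := by
          ext1 x
          exact add_zero x
        exact (congrArg (· ∈ X.group) h).mpr X.group.one_mem
      add_mem' := fun {v w} hv hw => by
        have h : IsometryEquiv.addRight (v + w) =
            IsometryEquiv.addRight w * IsometryEquiv.addRight v := by
          ext1 x
          exact (add_assoc x v w).symm
        exact (congrArg (· ∈ X.group) h).mpr (X.group.mul_mem hw hv)
      neg_mem' := fun {v} hv => by
        have h : IsometryEquiv.addRight (-v) = (IsometryEquiv.addRight v)⁻¹ := by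
          ext1 x
          rfl
        exact (congrArg (· ∈ X.group) h).mpr (X.group.inv_mem hv) }

variable {X}

theorem mem_translationLattice {v : EuclideanPlane} :
    v ∈ X.translationLattice ↔ IsometryEquiv.addRight v ∈ X.group :=
  Iff.rfl

/-- Proper discontinuity leaves finitely many translations in the unit ball. Discreteness makes the
lattice a finitely generated group. -/
instance : DiscreteTopology X.translationLattice := by
  have hfin : (ball (0 : X.translationLattice) 1).Finite := by
    refine Set.Finite.of_finite_image (f := fun v => IsometryEquiv.addRight v.1)
      ((X.finite_setOf_norm_apply_zero_le 1).subset ?_) ?_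
    · rintro _ ⟨v, hv, rfl⟩
      refine ⟨v.2, ?_⟩
      have : ‖v.1‖ < 1 := by simpa using hv
      simpa using this.le
    · intro v _ w _ hvw
      have := DFunLike.congr_fun hvw 0
      exact Subtype.ext (by simpa using this)
  refine discreteTopology_of_isOpen_singleton_zero ?_
  by_contra h
  have : (nhdsWithin (0 : X.translationLattice) {0}ᶜ).NeBot :=
    ⟨fun h' => h (isOpen_singleton_iff_punctured_nhds _ |>.2 h')⟩
  exact infinite_of_mem_nhds (0 : X.translationLattice) (ball_mem_nhds _ one_pos) hfin

variable (X) in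
/-- The inclusion of the translation lattice. -/
noncomputable def translationHom : Multiplicative X.translationLattice →* X.group where
  toFun v := ⟨IsometryEquiv.addRight v.toAdd.1, v.toAdd.2⟩
  map_one' := Subtype.ext (by ext1 x; exact add_zero x)
  map_mul' v w := by
    rw [mul_comm]
    exact Subtype.ext (by ext1 x; exact (add_assoc x _ _).symm)

theorem translationHom_injective : Function.Injective X.translationHom := by
  intro v w h
  have := DFunLike.congr_fun (congrArg Subtype.val h) 0
  apply Multiplicative.toAdd.injective
  exact Subtype.ext (by simpa [translationHom] using this)

theorem range_translationHom : X.translationHom.range = (linearPart.comp X.group.subtype).ker := by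
  ext g
  rw [MonoidHom.mem_ker]
  constructor
  · rintro ⟨v, rfl⟩
    ext z
    have := toComplex_apply (X.translationHom v).1 (toComplex.symm z)
    simp only [translationHom, MonoidHom.coe_mk, OneHom.coe_mk, IsometryEquiv.addRight_apply,
      map_add, LinearIsometryEquiv.apply_symm_apply, zero_add, add_left_inj] at this
    exact this.symm
  · intro hg
    have h := apply_eq_add_of_linearPart_eq_one hg
    have hg' : IsometryEquiv.addRight (g.1 0) = g.1 := by
      ext1 x
      exact (h x).symm
    refine ⟨.ofAdd ⟨g.1 0, mem_translationLattice.2 (hg'.symm ▸ g.2)⟩, Subtype.ext hg'⟩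

/-- The quotient by the translations is isomorphic to the point group, which is finite. -/
instance : X.translationHom.range.FiniteIndex := by
  rw [range_translationHom]
  have : Finite (linearPart.comp X.group.subtype).range := by
    refine (X.finite_image_linearPart.subset ?_).to_subtype
    rintro _ ⟨g, rfl⟩
    exact ⟨g.1, g.2, rfl⟩
  exact Subgroup.finiteIndex_ker _

/-- The formula through the linear part serves to show that w depends additively on v. -/
theorem exists_conj_translationHom_eq (g : X.group) (v : X.translationLattice) :
    ∃ w : X.translationLattice,
      g * X.translationHom (.ofAdd v) * g⁻¹ = X.translationHom (.ofAdd w) ∧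
        toComplex w = linearPart g.1 (toComplex v) := by
  have hmem : X.translationHom (.ofAdd v) ∈ X.translationHom.range := ⟨_, rfl⟩
  rw [range_translationHom] at hmem
  have hconj := (MonoidHom.normal_ker _).conj_mem _ hmem g
  rw [← range_translationHom] at hconj
  obtain ⟨w, hw⟩ := hconj
  refine ⟨w.toAdd, hw.symm, ?_⟩
  have h1 := toComplex_conj_apply_zero hmem g.1
  have h2 : (g.1 * (X.translationHom (.ofAdd v)).1 * g.1⁻¹) 0 = w.toAdd.1 := by
    have := DFunLike.congr_fun (congrArg Subtype.val hw) 0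
    simpa [translationHom] using this.symm
  rw [← h2]
  refine h1.trans ?_
  simp [translationHom]

variable (X) in
/-- The conjugation action on the translation lattice. -/
noncomputable def conjAction (g : X.group) : Module.End ℤ X.translationLattice :=
  AddMonoidHom.toIntLinearMap <| AddMonoidHom.mk' (fun v => (exists_conj_translationHom_eq g v).choose)
    fun v w => by
      apply Subtype.ext
      apply toComplex.injective
      have h := fun v => (exists_conj_translationHom_eq g v).choose_spec.2
      refine (h (v + w)).trans ?_
      rw [Submodule.coe_add, Submodule.coe_add, map_add, map_add, map_add, h v, h w]

theorem conj_translationHom (g : X.group) (v : X.translationLattice) :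
    g * X.translationHom (.ofAdd v) * g⁻¹ = X.translationHom (.ofAdd (X.conjAction g v)) :=
  (exists_conj_translationHom_eq g v).choose_spec.1

end ClosedEuclideanTwoOrbifold

theorem mainTheorem10 (X : ClosedEuclideanTwoOrbifold) (G : Type*) [Group G]
    (e : G ≃* X.fundamentalGroup) :
    (∀ γ : ProfiniteGrp.ProfiniteCompletion.completion (GrpCat.of G), IsOfFinOrder γ →
      ∃ g : G, IsOfFinOrder g ∧ IsConj (toProfiniteCompletion G g) γ) ∧
    (∀ g h : G, IsOfFinOrder g → IsOfFinOrder h →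
      IsConj (toProfiniteCompletion G g) (toProfiniteCompletion G h) → IsConj g h) := by
  let e' : G ≃* X.group := e.trans (MulEquiv.subgroupCongr X.fundamentalGroup_eq_group)
  let τ : Multiplicative X.translationLattice →* G := e'.symm.toMonoidHom.comp X.translationHom
  have hτ : Function.Injective τ :=
    e'.symm.injective.comp ClosedEuclideanTwoOrbifold.translationHom_injective
  have hρ (g : G) (a : X.translationLattice) :
      g * τ (.ofAdd a) * g⁻¹ = τ (.ofAdd (X.conjAction (e' g) a)) := by
    apply e'.injective
    simpa [τ] using ClosedEuclideanTwoOrbifold.conj_translationHom (e' g) a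
  have hfi : τ.range.FiniteIndex := by
    refine ⟨?_⟩
    rw [MonoidHom.range_comp]
    have : (X.translationHom.range.map e'.symm.toMonoidHom).index = X.translationHom.range.index :=
      Subgroup.index_map_equiv _ e'.symm
    rw [this]
    exact Subgroup.FiniteIndex.index_ne_zero
  have htf : IsAddTorsionFree X.translationLattice :=
    have : IsAddTorsionFree EuclideanPlane := IsAddTorsionFree.of_module_rat EuclideanPlane
    X.translationLattice.subtype_injective.isAddTorsionFree
      X.translationLattice.subtype.toAddMonoidHom
  exact ⟨fun γ hγ => exists_isOfFinOrder_isConj_toProfiniteCompletion hτ hρ hγ,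
    fun g h _ _ hgh => isConj_of_isConj_toProfiniteCompletion hτ hρ hgh⟩
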